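/- A closure operator $\varphi$ on a set $A$ is called a \emph{convex geometry} if $\varphi(\emptyset)=\emptyset$ and, whenever $Y=\varphi(Y)$ and $x\neq z$ are elements outside $Y$ with $z\in\varphi(Y\cup\{x\})$, one has $x\notin\varphi(Y\cup\{z\})$. Its \emph{alignment} is the family $\{Y\subseteq A:\varphi(Y)=Y\}$ of closed sets, a lattice with meet $Y\cap Z$ and join $\varphi(Y\cup Z)$. We say that $\varphi$ satisfies (a) the \emph{$n$-Carousel rule} if $S\subseteq A$ and $x,y\in\varphi(S)$ imply $x\in\varphi(\{y,a_1,\dots,a_n\})$ for some $a_1,\dots,a_n\in S$; (b) the \emph{Weak $n$-Carousel rule} if $S\subseteq A$ and $x,y\in\varphi(S)$ imply $x\in\varphi(\{y,a_1,\dots,a_n\})$ or $y\in\varphi(\{x,a_1,\dots,a_n\})$ for some $a_1,\dots,a_n\in S$; (c) the \emph{Weak $2\times 3$-Carousel rule} if $S\subseteq A$, $|S|=3$ and $x,y\in\varphi(S)$ imply $x\in\varphi(\{y,a_1,a_2\})$ or $y\in\varphi(\{x,a_1,a_2\})$ for some $a_1,a_2\in S$ (the $a_i$ need not be distinct). For a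 set $X$ of circles in $\mathbb{R}^2$ (of radius $\ge 0$, so that points are allowed), the \emph{geometry of circles} on $X$ is the closure operator $ch_c(Y)=\{z\in X:\tilde z\subseteq \mathrm{conv}(\bigcup_{y\in Y}\tilde y)\}$, where $\tilde z$ is the set of points of $z$. A \emph{strong representation} of one closure system in another is a bijection between their alignments that preserves meets and joins. Let $G$ be the closure system on the five-element set $X_0=\{a_0,a_1,a_2,x,y\}$ defined by the single implication $\{a_0,a_1,a_2\}\to\{x,y\}$: its closed sets are the sets $Y\subseteq X_0$ such that $\{a_0,a_1,a_2\}\subseteq Y$ implies $\{x,y\}\subseteq Y$. Then: 1. $G$ is a convex geometry, and its alignment is $\mathcal{P}(X_0)\setminus\{\{a_0,a_1,a_2\},\{a_0,a_1,a_2,x\},\{a_0,a_1,a_2,y\}\}$. 2. $G$ fails the Weak $2\times 3$-Carousel rule; hence it also fails the Weak $2$-Carousel rule and the $2$-Carousel rule. 3. $G$ has no strong representation by circles in the plane, that is, no strong representation in the geometry of circles on any set $X$ of circles in $\mathbb{R}^2$. 4. $G$ is minimal, both in the size of its base set and in the size of its alignment, among the finite convex geometries that fail the Weak $2\times 3$-Carousel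 rule: every finite convex geometry that fails this rule has a base set of at least as many elements as $X_0$ and an alignment of at least as many members as that of $G$. -/

import Mathlib

/-- The alignment of a closure operator `φ`: the family of its closed sets. -/
def alignment {A : Type*} (φ : ClosureOperator (Set A)) : Set (Set A) :=
  {Y | φ Y = Y}

/-- A closure operator on (the subsets of) `A` is a convex geometry if the empty set is closed and
the anti-exchange property holds. -/
def IsConvexGeometry {A : Type*} (φ : ClosureOperator (Set A)) : Prop :=
  φ ∅ = ∅ ∧
    ∀ Y : Set A, φ Y = Y → ∀ x z : A, x ∉ Y → z ∉ Y → x ≠ z →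
      z ∈ φ (Y ∪ {x}) → x ∉ φ (Y ∪ {z})

/-- The `n`-Carousel rule. -/
def CarouselRule {A : Type*} (n : ℕ) (φ : ClosureOperator (Set A)) : Prop :=
  ∀ (S : Set A) (x y : A), x ∈ φ S → y ∈ φ S →
    ∃ a : Fin n → A, (∀ i, a i ∈ S) ∧ x ∈ φ ({y} ∪ Set.range a)

/-- The Weak `n`-Carousel rule. -/
def WeakCarouselRule {A : Type*} (n : ℕ) (φ : ClosureOperator (Set A)) : Prop :=
  ∀ (S : Set A) (x y : A), x ∈ φ S → y ∈ φ S →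
    ∃ a : Fin n → A, (∀ i, a i ∈ S) ∧
      (x ∈ φ ({y} ∪ Set.range a) ∨ y ∈ φ ({x} ∪ Set.range a))

/-- The Weak `2 × 3`-Carousel rule. -/
def WeakCarouselRule23 {A : Type*} (φ : ClosureOperator (Set A)) : Prop :=
  ∀ (S : Set A) (x y : A), S.ncard = 3 → x ∈ φ S → y ∈ φ S →
    ∃ a₁ ∈ S, ∃ a₂ ∈ S, x ∈ φ {y, a₁, a₂} ∨ y ∈ φ {x, a₁, a₂}

/-- `f` embeds the lattice of closed sets of `φ` into that of `ψ`: it is one-to-one and preserves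
meets (intersections) and joins (the join of two closed sets is the closure of their union).
Only the values of `f` on closed sets matter. -/
def IsWeakRepresentation {A B : Type*} (φ : ClosureOperator (Set A)) (ψ : ClosureOperator (Set B))
    (f : Set A → Set B) : Prop :=
  Set.MapsTo f (alignment φ) (alignment ψ) ∧ Set.InjOn f (alignment φ) ∧
    ∀ Y ∈ alignment φ, ∀ Z ∈ alignment φ,
      f (Y ∩ Z) = f Y ∩ f Z ∧ f (φ (Y ∪ Z)) = ψ (f Y ∪ f Z)

/-- `φ` has a strong representation in `ψ`: an embedding of the lattices of closed sets that is
also onto. -/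
def HasStrongRepresentation {A B : Type*}
    (φ : ClosureOperator (Set A)) (ψ : ClosureOperator (Set B)) : Prop :=
  ∃ f : Set A → Set B, IsWeakRepresentation φ ψ f ∧ Set.SurjOn f (alignment φ) (alignment ψ)

/-- A circle in the Euclidean plane; circles of radius zero are the points. -/
structure PlaneCircle where
  center : EuclideanSpace ℝ (Fin 2)
  radius : ℝ
  radius_nonneg : 0 ≤ radius

/-- The set of points of a circle. -/
def PlaneCircle.points (c : PlaneCircle) : Set (EuclideanSpace ℝ (Fin 2)) :=
  Metric.sphere c.center c.radius

/-- The geometry of circles on a set `X` of circles in the plane: the closure of `Y ⊆ X` consists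
of the circles in `X` that lie in the convex hull of the union of the circles in `Y`. -/
def circleGeometry (X : Set PlaneCircle) : ClosureOperator (Set X) where
  toFun Y := {z | z.1.points ⊆ convexHull ℝ (⋃ y ∈ Y, y.1.points)}
  monotone' _ _ h _ hz :=
    Set.Subset.trans hz (convexHull_mono (Set.biUnion_subset_biUnion_left h))
  le_closure' Y _ hz :=
    Set.Subset.trans (Set.subset_biUnion_of_mem (u := fun y : X => y.1.points) hz)
      (subset_convexHull ℝ _)
  idempotent' _ :=
    Set.Subset.antisymm
      (fun _ hz => Set.Subset.trans hz
        (convexHull_min (Set.iUnion₂_subset fun _ hy => hy) (convex_convexHull ℝ _)))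
      (fun _ hz => Set.Subset.trans
        (Set.subset_biUnion_of_mem (u := fun y : X => y.1.points) hz) (subset_convexHull ℝ _))

/-- The closure system on `A` with the implicational basis `I`, where a pair `(P, Q)` stands for
the implication `P → Q`: the closed sets are those that satisfy all implications in `I`, and the
closure of a set is the least closed set that contains it. -/
def implicationClosure {A : Type*} (I : Set (Set A × Set A)) : ClosureOperator (Set A) :=
  ClosureOperator.ofCompletePred (fun Y => ∀ i ∈ I, i.1 ⊆ Y → i.2 ⊆ Y)
    (fun _ hs i hi h => Set.subset_sInter fun Y hY =>
      hs Y hY i hi (h.trans (Set.sInter_subset_of_mem hY)))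

/-- The five-element base set `{a₀, a₁, a₂, x, y}`. -/
inductive BaseSet : Type
  | a₀ | a₁ | a₂ | x | y
  deriving DecidableEq

/-- The closure system on `{a₀, a₁, a₂, x, y}` defined by the single implication
`a₀a₁a₂ → xy`. -/
def exampleGeometry : ClosureOperator (Set BaseSet) :=
  implicationClosure {({BaseSet.a₀, BaseSet.a₁, BaseSet.a₂}, {BaseSet.x, BaseSet.y})}

/-!
Everything but the statements about circles is a short verification.

*Circles.* The geometry of circles always satisfies the Weak `2 × 3`-Carousel rule
(`weakCarouselRule23_circleGeometry`). Write `h_c(u) = ⟪center, u⟫ + radius` for the support function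
of a circle `c` on unit vectors `u`. If the rule failed for `x, y` in the hull of `a₀, a₁, a₂`, then
separation would give, for each index `k`, unit vectors `u_k` and `v_k` such that `h_x` exceeds `h_y`
and both `h_{a_i}`, `i ≠ k`, at `u_k`, and `h_y` exceeds `h_x` and both `h_{a_i}`, `i ≠ k`, at `v_k`;
hence `h_{a_k}` is at least `h_x` at `u_k` and `v_k`. A difference of two support functions
is the restriction of an affine function to the unit circle, so its positivity set is an arc: if it
is positive at `p`, `q` and nonpositive at `a`, `b`, then `a` and `b` are strictly on the same side of
the line `pq` (`orient_mul_orient_pos`). Applied to `h_x - h_{a_k}`, this puts `v_k` on the same side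
of the line through `u_i, u_j` as `u_k`; applied to `h_x - h_y`, it puts all the `v`'s on one side of
that line. So `v₀` lies in the interior of the triangle `u₀u₁u₂`, which is impossible because the affine
function `h_x - h_y` is positive at the vertices and negative at `v₀`.

*Representations.* If all singletons are closed, a strong representation sends them to
atoms, and an atom is the closure of any of its points. Hence the rule passes from the representing
geometry to the represented one (`WeakCarouselRule23.of_hasStrongRepresentation`), whereas the
example violates it.

*Minimality.* If `{a₀, a₁, a₂}`, `x`, `y` violate the rule in a convex geometry, then the five points are
distinct, and anti-exchange shows that no `a_k` is in the closure of the other four.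
The violation itself says that neither of `x`, `y` is in the closure of the other and two `a_i`. So
every closed set of the example is the trace on the five points of its own closure, and taking
closures embeds the alignment of the example in that of the given geometry.
-/

/-! ### The example -/

theorem mem_alignment_exampleGeometry {Y : Set BaseSet} :
    Y ∈ alignment exampleGeometry ↔
      (BaseSet.a₀ ∈ Y → BaseSet.a₁ ∈ Y → BaseSet.a₂ ∈ Y → BaseSet.x ∈ Y ∧ BaseSet.y ∈ Y) := by
  have h : Y ∈ alignment exampleGeometry ↔ exampleGeometry.IsClosed Y :=
    exampleGeometry.isClosed_iff.symm
  rw [h]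
  change (∀ i ∈ ({({BaseSet.a₀, BaseSet.a₁, BaseSet.a₂}, {BaseSet.x, BaseSet.y})} :
    Set (Set BaseSet × Set BaseSet)), i.1 ⊆ Y → i.2 ⊆ Y) ↔ _
  simp [Set.insert_subset_iff]

theorem exampleGeometry_apply_of_mem {Y : Set BaseSet} (h : Y ∈ alignment exampleGeometry) :
    exampleGeometry Y = Y := h

theorem xy_mem_exampleGeometry {Y : Set BaseSet} (h₀ : BaseSet.a₀ ∈ Y) (h₁ : BaseSet.a₁ ∈ Y)
    (h₂ : BaseSet.a₂ ∈ Y) : BaseSet.x ∈ exampleGeometry Y ∧ BaseSet.y ∈ exampleGeometry Y :=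
  mem_alignment_exampleGeometry.1 (exampleGeometry.idempotent Y)
    (exampleGeometry.le_closure Y h₀) (exampleGeometry.le_closure Y h₁)
    (exampleGeometry.le_closure Y h₂)

theorem isConvexGeometry_exampleGeometry : IsConvexGeometry exampleGeometry := by
  refine ⟨mem_alignment_exampleGeometry.2 (by simp), fun Y hY p q hp hq hpq hqY hpY => ?_⟩
  have hY' := mem_alignment_exampleGeometry.1 hY
  -- Adding a point to a closed set either gives a closed set or completes the premise;
  -- in the second case the added point is one of the `aᵢ`.
  have key : ∀ {r s : BaseSet}, r ∉ Y → s ∉ Y → r ≠ s → s ∈ exampleGeometry (Y ∪ {r}) →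
      (r ≠ BaseSet.x ∧ r ≠ BaseSet.y) ∧ (s = BaseSet.x ∨ s = BaseSet.y) := by
    intro r s hr hs hrs h
    have hsr : s ∉ Y ∪ {r} := by
      rintro (h' | h')
      · exact hs h'
      · exact hrs h'.symm
    have hprem : BaseSet.a₀ ∈ Y ∪ {r} ∧ BaseSet.a₁ ∈ Y ∪ {r} ∧ BaseSet.a₂ ∈ Y ∪ {r} := by
      by_contra hc
      rw [exampleGeometry_apply_of_mem (mem_alignment_exampleGeometry.2
        fun a b c => absurd ⟨a, b, c⟩ hc)] at h
      exact hsr h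
    obtain ⟨h0, h1, h2⟩ := hprem
    constructor
    · constructor
      · rintro rfl
        simp only [Set.union_singleton, Set.mem_insert_iff, reduceCtorEq, false_or] at h0 h1 h2
        exact hr (hY' h0 h1 h2).1
      · rintro rfl
        simp only [Set.union_singleton, Set.mem_insert_iff, reduceCtorEq, false_or] at h0 h1 h2
        exact hr (hY' h0 h1 h2).2
    · cases s
      · exact absurd h0 hsr
      · exact absurd h1 hsr
      · exact absurd h2 hsr
      · exact Or.inl rfl
      · exact Or.inr rfl
  obtain ⟨-, h2⟩ := key hp hq hpq hqY
  obtain ⟨h3, -⟩ := key hq hp hpq.symm hpY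
  rcases h2 with h | h
  exacts [h3.1 h, h3.2 h]

theorem alignment_exampleGeometry :
    alignment exampleGeometry =
      Set.univ \ {{BaseSet.a₀, BaseSet.a₁, BaseSet.a₂},
        {BaseSet.a₀, BaseSet.a₁, BaseSet.a₂, BaseSet.x},
        {BaseSet.a₀, BaseSet.a₁, BaseSet.a₂, BaseSet.y}} := by
  have all : ∀ P : BaseSet → Prop, (∀ b, P b) ↔
      P BaseSet.a₀ ∧ P BaseSet.a₁ ∧ P BaseSet.a₂ ∧ P BaseSet.x ∧ P BaseSet.y := fun P =>
    ⟨fun h => ⟨h _, h _, h _, h _, h _⟩, fun ⟨h0, h1, h2, h3, h4⟩ b => by cases b <;> assumption⟩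
  ext Y
  rw [mem_alignment_exampleGeometry]
  simp only [Set.mem_sdiff, Set.mem_univ, true_and, Set.mem_insert_iff, Set.mem_singleton_iff,
    Set.ext_iff, all, reduceCtorEq, or_false, or_true, iff_true, iff_false]
  tauto

/-- The failure of the rule in the example, for the set `{a₀, a₁, a₂}` and the points `x`, `y`. -/
theorem notMem_exampleGeometry {r s : BaseSet} (hr : r = BaseSet.x ∨ r = BaseSet.y)
    {T : Set BaseSet} (hs : s = BaseSet.x ∨ s = BaseSet.y) (hrs : r ≠ s)
    (hT : T ⊆ {BaseSet.a₀, BaseSet.a₁, BaseSet.a₂})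
    (hT' : ¬ (BaseSet.a₀ ∈ T ∧ BaseSet.a₁ ∈ T ∧ BaseSet.a₂ ∈ T)) :
    r ∉ exampleGeometry (insert s T) := by
  rw [exampleGeometry_apply_of_mem (mem_alignment_exampleGeometry.2 fun h0 h1 h2 => ?_)]
  · rintro (h | h)
    · exact hrs h
    · rcases hr with rfl | rfl <;> simpa using hT h
  · refine absurd ⟨?_, ?_, ?_⟩ hT' <;> rcases hs with rfl | rfl <;> simp_all

theorem not_weakCarouselRule_exampleGeometry : ¬ WeakCarouselRule 2 exampleGeometry := by
  intro h
  obtain ⟨hx, hy⟩ := xy_mem_exampleGeometry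
    (Y := {BaseSet.a₀, BaseSet.a₁, BaseSet.a₂}) (by simp) (by simp) (by simp)
  obtain ⟨a, ha, h⟩ := h _ _ _ hx hy
  have hT : Set.range a ⊆ {BaseSet.a₀, BaseSet.a₁, BaseSet.a₂} := Set.range_subset_iff.2 ha
  have hT' : ¬ (BaseSet.a₀ ∈ Set.range a ∧ BaseSet.a₁ ∈ Set.range a ∧
      BaseSet.a₂ ∈ Set.range a) := by
    rintro ⟨⟨i, hi⟩, ⟨j, hj⟩, ⟨k, hk⟩⟩
    have hij : i ≠ j := by rintro rfl; simp [hi] at hj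
    have hik : i ≠ k := by rintro rfl; simp [hi] at hk
    have hjk : j ≠ k := by rintro rfl; simp [hj] at hk
    lia
  rcases h with h | h
  · exact notMem_exampleGeometry (Or.inl rfl) (Or.inr rfl) (by simp) hT hT' h
  · exact notMem_exampleGeometry (Or.inr rfl) (Or.inl rfl) (by simp) hT hT' h

theorem not_weakCarouselRule23_exampleGeometry : ¬ WeakCarouselRule23 exampleGeometry := by
  intro h
  obtain ⟨hx, hy⟩ := xy_mem_exampleGeometry
    (Y := {BaseSet.a₀, BaseSet.a₁, BaseSet.a₂}) (by simp) (by simp) (by simp)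
  obtain ⟨a, ha, b, hb, h⟩ :=
    h _ _ _ (Set.ncard_eq_three.2 ⟨_, _, _, by simp, by simp, by simp, rfl⟩) hx hy
  have hT : ({a, b} : Set BaseSet) ⊆ {BaseSet.a₀, BaseSet.a₁, BaseSet.a₂} :=
    Set.insert_subset ha (Set.singleton_subset_iff.2 hb)
  have hT' : ¬ (BaseSet.a₀ ∈ ({a, b} : Set BaseSet) ∧ BaseSet.a₁ ∈ ({a, b} : Set BaseSet) ∧
      BaseSet.a₂ ∈ ({a, b} : Set BaseSet)) := by
    cases a <;> cases b <;> simp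
  rcases h with h | h
  · exact notMem_exampleGeometry (Or.inl rfl) (Or.inr rfl) (by simp) hT hT' h
  · exact notMem_exampleGeometry (Or.inr rfl) (Or.inl rfl) (by simp) hT hT' h

/-! ### Strong representations -/

/-- A strong representation identifies the lattices of closed sets, and when points are closed in `φ`
the singletons correspond to atoms, each generated by one point of `B`. -/
theorem WeakCarouselRule23.of_hasStrongRepresentation {A B : Type*}
    {φ : ClosureOperator (Set A)} {ψ : ClosureOperator (Set B)}
    (hφ : φ ∅ = ∅) (hφ' : ∀ a, φ {a} = {a}) (hψ : ψ ∅ = ∅)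
    (h : HasStrongRepresentation φ ψ) (hrule : WeakCarouselRule23 ψ) : WeakCarouselRule23 φ := by
  obtain ⟨f, ⟨hmaps, hinj, hf⟩, hsurj⟩ := h
  have hcl : ∀ Y, φ Y ∈ alignment φ := φ.idempotent
  have hle : ∀ {Y Z}, Y ∈ alignment φ → Z ∈ alignment φ → (f Y ⊆ f Z ↔ Y ⊆ Z) := by
    intro Y Z hY hZ
    have hYZ : Y ∩ Z ∈ alignment φ := by
      refine Set.Subset.antisymm (Set.subset_inter ?_ ?_) (φ.le_closure _)
      · exact (φ.monotone Set.inter_subset_left).trans hY.le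
      · exact (φ.monotone Set.inter_subset_right).trans hZ.le
    rw [← Set.inter_eq_left, ← (hf Y hY Z hZ).1, hinj.eq_iff hYZ hY, Set.inter_eq_left]
  have hbot : f ∅ = ∅ := by
    obtain ⟨W, hW, hWe⟩ := hsurj (show ∅ ∈ alignment ψ from hψ)
    have := (hf ∅ hφ W hW).1
    rwa [hWe, Set.empty_inter, Set.inter_empty] at this
  have hatom : ∀ a, ∃ b, f {a} = ψ {b} := by
    intro a
    have hne : (f {a}).Nonempty := by
      rw [Set.nonempty_iff_ne_empty, ← hbot]
      intro he
      exact Set.singleton_ne_empty a (hinj (hφ' a) hφ he)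
    obtain ⟨b, hb⟩ := hne
    refine ⟨b, ?_⟩
    obtain ⟨W, hW, hWe⟩ := hsurj (show ψ {b} ∈ alignment ψ from ψ.idempotent _)
    have hsub : ψ {b} ⊆ f {a} :=
      (ψ.monotone (Set.singleton_subset_iff.2 hb)).trans (hmaps (hφ' a)).le
    rw [← hWe, hle hW (hφ' a), Set.subset_singleton_iff_eq] at hsub
    rcases hsub with rfl | rfl
    · have : b ∈ ψ {b} := ψ.le_closure _ rfl
      rw [← hWe, hbot] at this
      exact this.elim
    · exact hWe
  choose g hg using hatom
  have htriple : ∀ a b c, f (φ {a, b, c}) = ψ {g a, g b, g c} := by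
    intro a b c
    have hsup : ∀ Y a, φ (insert a Y) = φ ({a} ∪ φ Y) := by
      intro Y a
      exact (φ.closure_sup_closure_right {a} Y).symm
    have hsup' : ∀ Y b, ψ (insert b Y) = ψ (ψ {b} ∪ ψ Y) := by
      intro Y a
      exact (ψ.closure_sup_closure {a} Y).symm
    rw [hsup, (hf _ (hφ' a) _ (hcl _)).2, hsup {c} b, hφ' c,
      (hf _ (hφ' b) _ (hφ' c)).2, hsup' _ (g a), hsup' _ (g b), hg, hg, hg]
  have hmem : ∀ p a b c, g p ∈ ψ {g a, g b, g c} ↔ p ∈ φ {a, b, c} := by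
    intro p a b c
    rw [← htriple, ← Set.singleton_subset_iff (s := φ {a, b, c}), ← hle (hφ' p) (hcl _), hg]
    refine ⟨fun h => (ψ.monotone (Set.singleton_subset_iff.2 h)).trans (hmaps (hcl _)).le,
      fun h => h (ψ.le_closure _ rfl)⟩
  have hginj : Function.Injective g := fun a b hab =>
    Set.singleton_injective (hinj (hφ' a) (hφ' b) (by rw [hg, hg, hab]))
  intro S x y hS hx hy
  obtain ⟨a, b, c, hab, hac, hbc, rfl⟩ := Set.ncard_eq_three.1 hS
  obtain ⟨p, hp, q, hq, h⟩ := hrule {g a, g b, g c} (g x) (g y)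
    (Set.ncard_eq_three.2 ⟨_, _, _, hginj.ne hab, hginj.ne hac, hginj.ne hbc, rfl⟩)
    ((hmem _ _ _ _).2 hx) ((hmem _ _ _ _).2 hy)
  have himage : ({g a, g b, g c} : Set B) = g '' {a, b, c} := by
    simp [Set.image_insert_eq]
  rw [himage] at hp hq
  obtain ⟨p, hp, rfl⟩ := hp
  obtain ⟨q, hq, rfl⟩ := hq
  exact ⟨p, hp, q, hq, h.imp (hmem _ _ _ _).1 (hmem _ _ _ _).1⟩

/-! ### Arcs of the unit circle -/

/-- Twice the signed area of the triangle `pqr`; its sign tells the side of the line `pq` on which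
`r` lies. -/
def orient (p q r : EuclideanSpace ℝ (Fin 2)) : ℝ :=
  (q 0 - p 0) * (r 1 - p 1) - (q 1 - p 1) * (r 0 - p 0)

theorem orient_rotate (p q r : EuclideanSpace ℝ (Fin 2)) : orient q r p = orient p q r := by
  unfold orient; ring

theorem sq_add_sq_pos_of_ne {p q : EuclideanSpace ℝ (Fin 2)} (hpq : p ≠ q) :
    0 < (q 0 - p 0) ^ 2 + (q 1 - p 1) ^ 2 := by
  by_contra! h
  refine hpq (PiLp.ext (Fin.forall_fin_two.2 ⟨?_, ?_⟩))
  · nlinarith [sq_nonneg (q 0 - p 0), sq_nonneg (q 1 - p 1)]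
  · nlinarith [sq_nonneg (q 0 - p 0), sq_nonneg (q 1 - p 1)]

theorem exists_eq_of_orient_eq_zero {p q z : EuclideanSpace ℝ (Fin 2)} (hpq : p ≠ q)
    (h : orient p q z = 0) :
    ∃ t : ℝ, z 0 = p 0 + t * (q 0 - p 0) ∧ z 1 = p 1 + t * (q 1 - p 1) := by
  have hn := (sq_add_sq_pos_of_ne hpq).ne'
  unfold orient at h
  refine ⟨((q 0 - p 0) * (z 0 - p 0) + (q 1 - p 1) * (z 1 - p 1)) /
    ((q 0 - p 0) ^ 2 + (q 1 - p 1) ^ 2), ?_, ?_⟩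
  · rw [div_mul_eq_mul_div, ← sub_eq_iff_eq_add', eq_div_iff hn]
    linear_combination (-(q 1 - p 1)) * h
  · rw [div_mul_eq_mul_div, ← sub_eq_iff_eq_add', eq_div_iff hn]
    linear_combination (q 0 - p 0) * h

/-- The positivity set of an affine function on the unit circle is an arc, so a chord that joins two
of its points has all of the complement on one side. -/
theorem orient_mul_orient_pos {p q a b w : EuclideanSpace ℝ (Fin 2)} {γ : ℝ} (hp : ‖p‖ = 1)
    (hq : ‖q‖ = 1) (ha : ‖a‖ = 1) (hb : ‖b‖ = 1) (hpq : p ≠ q)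
    (hwp : 0 < inner ℝ w p + γ) (hwq : 0 < inner ℝ w q + γ)
    (hwa : inner ℝ w a + γ ≤ 0) (hwb : inner ℝ w b + γ ≤ 0) :
    0 < orient p q a * orient p q b := by
  by_contra! hneg
  -- Otherwise the segment `ab` meets the line `pq` in a point `z` of the unit disc,
  -- and the disc cuts the line in the chord `pq`.
  obtain ⟨s, hs0, hs1, hs⟩ : ∃ s : ℝ, 0 ≤ s ∧ s ≤ 1 ∧
      (1 - s) * orient p q a + s * orient p q b = 0 := by
    by_cases h0 : orient p q a = 0
    · exact ⟨0, le_rfl, zero_le_one, by simp [h0]⟩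
    · have hne : 0 < orient p q a * (orient p q a - orient p q b) := by
        have := mul_self_pos.2 h0
        linarith [mul_sub (orient p q a) (orient p q a) (orient p q b)]
      have hd : orient p q a - orient p q b ≠ 0 := right_ne_zero_of_mul hne.ne'
      have hs : orient p q a / (orient p q a - orient p q b) =
          orient p q a ^ 2 / (orient p q a * (orient p q a - orient p q b)) := by
        field_simp
      refine ⟨orient p q a / (orient p q a - orient p q b), ?_, ?_, by field_simp; ring⟩
      · rw [hs]; positivity
      · rw [hs, div_le_one hne]
        linarith [mul_sub (orient p q a) (orient p q a) (orient p q b)]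
  set z := (1 - s) • a + s • b with hz
  have hzn : ‖z‖ ≤ 1 := by
    refine (norm_add_le _ _).trans ?_
    rw [norm_smul, norm_smul, ha, hb, Real.norm_of_nonneg hs0, Real.norm_of_nonneg (by linarith)]
    linarith
  have hwz : inner ℝ w z + γ ≤ 0 := by
    rw [hz, inner_add_right, inner_smul_right, inner_smul_right]
    nlinarith
  have hoz : orient p q z = 0 := by
    rw [← hs, hz]
    simp only [orient, PiLp.add_apply, PiLp.smul_apply, smul_eq_mul]
    ring
  obtain ⟨t, ht0, ht1⟩ := exists_eq_of_orient_eq_zero hpq hoz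
  have hn : 0 < (q 0 - p 0) ^ 2 + (q 1 - p 1) ^ 2 := sq_add_sq_pos_of_ne hpq
  have hsq : ∀ v : EuclideanSpace ℝ (Fin 2), ‖v‖ ^ 2 = v 0 ^ 2 + v 1 ^ 2 := by
    intro v; simp [EuclideanSpace.norm_sq_eq]
  have hp2 := hsq p
  have hq2 := hsq q
  have hz2 : z 0 ^ 2 + z 1 ^ 2 ≤ 1 := by
    rw [← hsq]; exact pow_le_one₀ (norm_nonneg _) hzn
  rw [hp] at hp2
  rw [hq] at hq2
  -- `‖z‖² = 1 - t (1 - t) ‖q - p‖²`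
  have htt : 0 ≤ t * (1 - t) := by
    have : z 0 ^ 2 + z 1 ^ 2 = 1 - t * (1 - t) * ((q 0 - p 0) ^ 2 + (q 1 - p 1) ^ 2) := by
      rw [ht0, ht1]
      linear_combination (-(1 - t)) * hp2 - t * hq2
    exact nonneg_of_mul_nonneg_left (by linarith) hn
  have hwz' : inner ℝ w z + γ = (1 - t) * (inner ℝ w p + γ) + t * (inner ℝ w q + γ) := by
    simp only [PiLp.inner_apply, Fin.sum_univ_two, RCLike.inner_apply, conj_trivial]
    rw [ht0, ht1]
    ring
  have ht0' : 0 ≤ t := by nlinarith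
  have ht1' : t ≤ 1 := by nlinarith
  nlinarith [mul_nonneg ht0' hwq.le, mul_nonneg (sub_nonneg.2 ht1') hwp.le]

/-! ### Support functions of circles -/

/-- The value at a unit vector `u` of the support function of a circle, that is, the maximum of
`⟪z, u⟫` over the points `z` of the circle. (For other vectors `u` it lacks the factor `‖u‖`.) -/
noncomputable def PlaneCircle.support (c : PlaneCircle) (u : EuclideanSpace ℝ (Fin 2)) : ℝ :=
  inner ℝ c.center u + c.radius

theorem PlaneCircle.support_sub_support (c d : PlaneCircle) (u : EuclideanSpace ℝ (Fin 2)) :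
    c.support u - d.support u = inner ℝ (c.center - d.center) u + (c.radius - d.radius) := by
  rw [PlaneCircle.support, PlaneCircle.support, inner_sub_left]; ring

theorem PlaneCircle.inner_le_support {c : PlaneCircle} {z u : EuclideanSpace ℝ (Fin 2)}
    (hz : z ∈ c.points) (hu : ‖u‖ = 1) : inner ℝ z u ≤ c.support u := by
  have h1 := real_inner_le_norm (z - c.center) u
  rw [hu, mul_one, mem_sphere_iff_norm.1 hz, inner_sub_left] at h1
  rw [PlaneCircle.support]
  linarith

theorem PlaneCircle.exists_inner_eq_support (c : PlaneCircle) {u : EuclideanSpace ℝ (Fin 2)}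
    (hu : ‖u‖ = 1) : ∃ z ∈ c.points, inner ℝ z u = c.support u := by
  refine ⟨c.center + c.radius • u, ?_, ?_⟩
  · simp [PlaneCircle.points, norm_smul, hu, abs_of_nonneg c.radius_nonneg]
  · rw [inner_add_left, real_inner_smul_left, real_inner_self_eq_norm_sq, hu, PlaneCircle.support]
    ring

theorem exists_support_le_of_mem_circleGeometry {X : Set PlaneCircle} {Y : Set X} {c : X}
    (h : c ∈ circleGeometry X Y) {u : EuclideanSpace ℝ (Fin 2)} (hu : ‖u‖ = 1) :
    ∃ d ∈ Y, c.1.support u ≤ d.1.support u := by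
  by_contra! hlt
  obtain ⟨z, hz, hzu⟩ := c.1.exists_inner_eq_support hu
  have hsub : convexHull ℝ (⋃ d ∈ Y, d.1.points) ⊆ {z | inner ℝ z u < c.1.support u} := by
    refine convexHull_min (Set.iUnion₂_subset fun d hd z hz => ?_) ?_
    · exact (PlaneCircle.inner_le_support hz hu).trans_lt (hlt d hd)
    · refine convex_halfSpace_lt ⟨fun x y => inner_add_left x y u, fun a x => ?_⟩ _
      rw [real_inner_smul_left, smul_eq_mul]
  exact (hsub (h hz)).ne hzu

theorem IsCompact.convexJoin {E : Type*} [AddCommGroup E] [Module ℝ E] [TopologicalSpace E]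
    [ContinuousAdd E] [ContinuousSMul ℝ E] {s t : Set E} (hs : IsCompact s) (ht : IsCompact t) :
    IsCompact (_root_.convexJoin ℝ s t) := by
  have himage : _root_.convexJoin ℝ s t =
      (fun p : ℝ × E × E => (1 - p.1) • p.2.1 + p.1 • p.2.2) '' (Set.Icc 0 1 ×ˢ s ×ˢ t) := by
    ext z
    simp only [mem_convexJoin, segment_eq_image, Set.mem_image, Set.mem_prod, Prod.exists]
    constructor
    · rintro ⟨a, ha, b, hb, r, hr, rfl⟩
      exact ⟨r, a, b, ⟨hr, ha, hb⟩, rfl⟩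
    · rintro ⟨r, a, b, ⟨hr, ha, hb⟩, rfl⟩
      exact ⟨a, ha, b, hb, r, hr, rfl⟩
  rw [himage]
  exact (isCompact_Icc.prod (hs.prod ht)).image (by fun_prop)

theorem PlaneCircle.points_nonempty (c : PlaneCircle) : c.points.Nonempty :=
  NormedSpace.sphere_nonempty.2 c.radius_nonneg

theorem isCompact_convexHull_biUnion_points {X : Set PlaneCircle} {Y : Set X} (hY : Y.Finite) :
    IsCompact (convexHull ℝ (⋃ d ∈ Y, d.1.points)) := by
  induction Y, hY using Set.Finite.induction_on with
  | empty => simp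
  | @insert c Z _ _ ih =>
    have hc : IsCompact (convexHull ℝ c.1.points) := by
      rw [PlaneCircle.points, convexHull_sphere_eq_closedBall _ c.1.radius_nonneg]
      exact isCompact_closedBall _ _
    rw [Set.biUnion_insert]
    obtain hZ | hZ := (⋃ d ∈ Z, d.1.points).eq_empty_or_nonempty
    · rwa [hZ, Set.union_empty]
    · rw [convexHull_union c.1.points_nonempty hZ]
      exact hc.convexJoin ih

theorem exists_support_lt_of_notMem_circleGeometry {X : Set PlaneCircle} {Y : Set X}
    (hY : Y.Finite) (hne : Y.Nonempty) {c : X} (h : c ∉ circleGeometry X Y) :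
    ∃ u : EuclideanSpace ℝ (Fin 2), ‖u‖ = 1 ∧ ∀ d ∈ Y, d.1.support u < c.1.support u := by
  obtain ⟨z, hz, hzY⟩ := Set.not_subset.1 h
  have hcomp : IsCompact (convexHull ℝ (⋃ d ∈ Y, d.1.points)) :=
    isCompact_convexHull_biUnion_points hY
  obtain ⟨f, s, hf, hs⟩ :=
    geometric_hahn_banach_closed_point (convex_convexHull ℝ _) hcomp.isClosed hzY
  set w := (InnerProductSpace.toDual ℝ (EuclideanSpace ℝ (Fin 2))).symm f with hw
  have hfw : ∀ v, f v = inner ℝ v w := fun v => by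
    rw [real_inner_comm, hw, InnerProductSpace.toDual_symm_apply]
  have hfd : ∀ d ∈ Y, ∀ v ∈ d.1.points, inner ℝ v w < inner ℝ z w := fun d hd v hv => by
    rw [← hfw, ← hfw]
    exact (hf v (subset_convexHull ℝ _ (Set.mem_biUnion hd hv))).trans hs
  have hw0 : w ≠ 0 := by
    intro h0
    obtain ⟨d, hd⟩ := hne
    obtain ⟨v, hv⟩ := d.1.points_nonempty
    simpa [h0] using hfd d hd v hv
  have hu : ‖(‖w‖⁻¹ • w)‖ = 1 := norm_smul_inv_norm (𝕜 := ℝ) hw0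
  refine ⟨‖w‖⁻¹ • w, hu, fun d hd => ?_⟩
  obtain ⟨v, hv, hvu⟩ := d.1.exists_inner_eq_support hu
  refine lt_of_lt_of_le ?_ (PlaneCircle.inner_le_support hz hu)
  rw [← hvu, real_inner_smul_right, real_inner_smul_right]
  exact mul_lt_mul_of_pos_left (hfd d hd v hv) (inv_pos.2 (norm_pos_iff.2 hw0))

/-! ### The Weak `2 × 3`-Carousel rule for circles -/

/-- The separation argument behind the rule: the six directions that a failure of the rule would
provide cannot exist. -/
theorem false_of_directions {a : Fin 3 → PlaneCircle} {x y : PlaneCircle}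
    {u v : Fin 3 → EuclideanSpace ℝ (Fin 2)} (hu : ∀ k, ‖u k‖ = 1) (hv : ∀ k, ‖v k‖ = 1)
    (huy : ∀ k, y.support (u k) < x.support (u k))
    (hvx : ∀ k, x.support (v k) < y.support (v k))
    (hua : ∀ k i, i ≠ k → (a i).support (u k) < x.support (u k))
    (hua' : ∀ k, x.support (u k) ≤ (a k).support (u k))
    (hva' : ∀ k, y.support (v k) ≤ (a k).support (v k)) : False := by
  have hne : ∀ i j, i ≠ j → u i ≠ u j := fun i j hij h =>
    absurd (hua' i) (by rw [h]; exact (hua j i hij).not_ge)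
  have hside : ∀ i j k, i ≠ j → k ≠ i → k ≠ j →
      0 < orient (u i) (u j) (u k) * orient (u i) (u j) (v k) := by
    intro i j k hij hki hkj
    refine orient_mul_orient_pos (w := x.center - (a k).center) (γ := x.radius - (a k).radius)
      (hu i) (hu j) (hu k) (hv k) (hne i j hij) ?_ ?_ ?_ ?_ <;>
      rw [← PlaneCircle.support_sub_support]
    · linarith [hua i k hki]
    · linarith [hua j k hkj]
    · linarith [hua' k]
    · linarith [hva' k, hvx k]
  have hside' : 0 < orient (u 0) (u 1) (v 2) * orient (u 0) (u 1) (v 0) ∧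
      0 < orient (u 2) (u 0) (v 1) * orient (u 2) (u 0) (v 0) := by
    constructor <;>
    · refine orient_mul_orient_pos (w := x.center - y.center) (γ := x.radius - y.radius)
        (hu _) (hu _) (hv _) (hv _) (hne _ _ (by decide)) ?_ ?_ ?_ ?_ <;>
        rw [← PlaneCircle.support_sub_support]
      · linarith [huy 0, huy 2]
      · linarith [huy 0, huy 1]
      · linarith [hvx 1, hvx 2]
      · linarith [hvx 0]
  have h0 := hside 1 2 0 (by decide) (by decide) (by decide)
  have h1 := hside 2 0 1 (by decide) (by decide) (by decide)
  have h2 := hside 0 1 2 (by decide) (by decide) (by decide)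
  rw [orient_rotate (u 0)] at h0
  rw [orient_rotate (u 1), orient_rotate (u 0)] at h1
  have trans_pos : ∀ {r s t : ℝ}, 0 < r * s → 0 < s * t → 0 < r * t := fun {r s t} h h' => by
    have h3 : 0 < r * t * (s * s) := by
      have := mul_pos h h'
      linarith [show r * s * (s * t) = r * t * (s * s) by ring]
    exact pos_of_mul_pos_left h3 (mul_self_nonneg s)
  have h1' := trans_pos h1 hside'.2
  have h2' := trans_pos h2 hside'.1
  -- Cramer's rule: the barycentric coordinates of `v 0` in the triangle are positive.
  have key : orient (u 0) (u 1) (u 2) ^ 2 * (x.support (v 0) - y.support (v 0)) =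
      orient (u 0) (u 1) (u 2) * orient (u 1) (u 2) (v 0) * (x.support (u 0) - y.support (u 0)) +
      orient (u 0) (u 1) (u 2) * orient (u 2) (u 0) (v 0) * (x.support (u 1) - y.support (u 1)) +
      orient (u 0) (u 1) (u 2) * orient (u 0) (u 1) (v 0) *
        (x.support (u 2) - y.support (u 2)) := by
    simp only [PlaneCircle.support_sub_support, orient, PiLp.inner_apply, Fin.sum_univ_two,
      RCLike.inner_apply, conj_trivial]
    ring
  have := mul_pos h0 (sub_pos.2 (huy 0))
  have := mul_pos h1' (sub_pos.2 (huy 1))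
  have := mul_pos h2' (sub_pos.2 (huy 2))
  have := mul_nonneg (sq_nonneg (orient (u 0) (u 1) (u 2))) (sub_nonneg.2 (hvx 0).le)
  linarith

theorem weakCarouselRule23_circleGeometry (X : Set PlaneCircle) :
    WeakCarouselRule23 (circleGeometry X) := by
  intro S x y hS hx hy
  by_contra! hfail
  obtain ⟨b₀, b₁, b₂, -, -, -, rfl⟩ := Set.ncard_eq_three.1 hS
  set a : Fin 3 → X := ![b₀, b₁, b₂] with ha
  have hS' : ({b₀, b₁, b₂} : Set X) = Set.range a := by
    ext c; simp [ha, @eq_comm _ c]; tauto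
  rw [hS'] at hx hy hfail
  have hdir : ∀ z w : X, (∀ i j, z ∉ circleGeometry X {w, a i, a j}) →
      z ∈ circleGeometry X (Set.range a) → ∀ k, ∃ u : EuclideanSpace ℝ (Fin 2), ‖u‖ = 1 ∧
        w.1.support u < z.1.support u ∧
        (∀ i, i ≠ k → (a i).1.support u < z.1.support u) ∧
        z.1.support u ≤ (a k).1.support u := by
    intro z w hz hzS k
    obtain ⟨u, hu, h⟩ := exists_support_lt_of_notMem_circleGeometry (Set.toFinite _)
      (Set.insert_nonempty _ _) (hz (k + 1) (k + 2))
    have hlt : ∀ i, i ≠ k → (a i).1.support u < z.1.support u := by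
      intro i hi
      obtain rfl | rfl : i = k + 1 ∨ i = k + 2 := by lia
      all_goals exact h _ (by simp)
    refine ⟨u, hu, h _ (by simp), hlt, ?_⟩
    obtain ⟨_, ⟨i, rfl⟩, hi⟩ := exists_support_le_of_mem_circleGeometry hzS hu
    by_cases hik : i = k
    · exact hik ▸ hi
    · exact absurd hi (hlt i hik).not_ge
  choose u hu huy hua hua' using hdir x y (fun i j => (hfail _ ⟨i, rfl⟩ _ ⟨j, rfl⟩).1) hx
  choose v hv hvx _ hva' using hdir y x (fun i j => (hfail _ ⟨i, rfl⟩ _ ⟨j, rfl⟩).2) hy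
  exact false_of_directions (a := fun i => (a i).1) hu hv huy hvx hua hua' hva'

theorem circleGeometry_empty (X : Set PlaneCircle) : circleGeometry X ∅ = ∅ := by
  refine Set.eq_empty_of_forall_notMem fun c hc => ?_
  have hc' : c.1.points ⊆ convexHull ℝ (⋃ y ∈ (∅ : Set X), y.1.points) := hc
  obtain ⟨z, hz⟩ := c.1.points_nonempty
  simpa using hc' hz

theorem not_hasStrongRepresentation_circleGeometry (X : Set PlaneCircle) :
    ¬ HasStrongRepresentation exampleGeometry (circleGeometry X) := fun h =>
  not_weakCarouselRule23_exampleGeometry <|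
    WeakCarouselRule23.of_hasStrongRepresentation isConvexGeometry_exampleGeometry.1
      (fun a => mem_alignment_exampleGeometry.2 (by cases a <;> simp)) (circleGeometry_empty X) h
      (weakCarouselRule23_circleGeometry X)

/-! ### Minimality of the example -/

/-- A failure of the Weak `2 × 3`-Carousel rule in a convex geometry embeds the example: `e`
sends the base set of the example into `A` so that every closed set of the example is
the trace of its closure in `A`. -/
theorem exists_trace_of_not_weakCarouselRule23 {A : Type*} {φ : ClosureOperator (Set A)}
    (hφ : IsConvexGeometry φ) (h : ¬ WeakCarouselRule23 φ) :
    ∃ e : BaseSet → A, Function.Injective e ∧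
      ∀ T ∈ alignment exampleGeometry, ∀ b, e b ∈ φ (e '' T) → b ∈ T := by
  unfold WeakCarouselRule23 at h
  push Not at h
  obtain ⟨S, x, y, hS, hx, hy, hfail⟩ := h
  obtain ⟨a₀, a₁, a₂, h01, h02, h12, rfl⟩ := Set.ncard_eq_three.1 hS
  -- A closed set that contains `a₀, a₁, a₂` contains `x` and `y`.
  have hfull : ∀ {r : A} {T : Set A}, r ∈ φ {a₀, a₁, a₂} → a₀ ∈ φ T → a₁ ∈ φ T → a₂ ∈ φ T →
      r ∈ φ T := by
    intro r T hr m0 m1 m2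
    have hsub : ({a₀, a₁, a₂} : Set A) ⊆ φ T := by
      rintro z (rfl | rfl | rfl) <;> assumption
    have := φ.monotone hsub hr
    rwa [φ.idempotent] at this
  have hmem : ∀ {z : A} {T : Set A}, z ∈ T → z ∈ φ T := fun {z T} hz => φ.le_closure T hz
  -- Anti-exchange for `x` and `c` over `φ {y, a, b}`.
  have hanti : ∀ a ∈ ({a₀, a₁, a₂} : Set A), ∀ b ∈ ({a₀, a₁, a₂} : Set A),
      ∀ c, ({a₀, a₁, a₂} : Set A) ⊆ {a, b, c} → c ∉ φ {x, y, a, b} := by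
    intro a ha b hb c hsub hc
    have hsub' : ∀ T, φ {y, a, b} ⊆ φ T → c ∈ φ T → x ∈ φ T := by
      intro T hT hcT
      have hT' : ∀ z ∈ ({a₀, a₁, a₂} : Set A), z ∈ φ T := by
        intro z hz
        rcases hsub hz with rfl | rfl | rfl
        · exact hT (hmem (by simp))
        · exact hT (hmem (by simp))
        · exact hcT
      exact hfull hx (hT' _ (by simp)) (hT' _ (by simp)) (hT' _ (by simp))
    have hxY := (hfail a ha b hb).1
    have hcY : c ∉ φ {y, a, b} := fun hc => hxY (hsub' _ le_rfl hc)
    refine hφ.2 (φ {y, a, b}) (φ.idempotent _) x c hxY hcY ?_ ?_ ?_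
    · rintro rfl
      -- `x = c` would give `y ∈ φ {x, a, b}`.
      refine (hfail a ha b hb).2 (φ.monotone ?_ hy)
      exact hsub.trans (by rintro z (rfl | rfl | rfl) <;> simp)
    · refine φ.monotone ?_ hc
      rintro z (rfl | rfl | rfl | rfl)
      · exact Or.inr rfl
      all_goals exact Or.inl (hmem (by simp))
    · exact hsub' _ (fun z hz => hmem (Or.inl hz)) (hmem (Or.inr rfl))
  let e : BaseSet → A := fun b => match b with
    | .a₀ => a₀ | .a₁ => a₁ | .a₂ => a₂ | .x => x | .y => y
  have htrace : ∀ T : Set BaseSet,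
      (BaseSet.a₀ ∈ T → BaseSet.a₁ ∈ T → BaseSet.a₂ ∈ T → BaseSet.x ∈ T ∧ BaseSet.y ∈ T) →
      ∀ b, e b ∈ φ (e '' T) → b ∈ T := by
    intro T hT b hb
    by_contra hbT
    have hmono : ∀ {k : BaseSet} {U : Set A}, k ∉ T →
        (∀ b, b ≠ k → e b ∈ U) → e b ∈ φ U := by
      intro k U hk hU
      refine φ.monotone ?_ hb
      rintro _ ⟨c, hc, rfl⟩
      exact hU c (by rintro rfl; exact hk hc)
    have hmono₂ : ∀ {k l : BaseSet} {U : Set A}, k ∉ T → l ∉ T →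
        (∀ b, b ≠ k → b ≠ l → e b ∈ U) → e b ∈ φ U := by
      intro k l U hk hl hU
      refine φ.monotone ?_ hb
      rintro _ ⟨c, hc, rfl⟩
      exact hU c (by rintro rfl; exact hk hc) (by rintro rfl; exact hl hc)
    have hmiss : b = BaseSet.x ∨ b = BaseSet.y →
        BaseSet.a₀ ∉ T ∨ BaseSet.a₁ ∉ T ∨ BaseSet.a₂ ∉ T := by
      rintro (rfl | rfl) <;> tauto
    cases b
    case a₀ =>
      exact hanti a₁ (by simp) a₂ (by simp) a₀ (by rintro z (rfl | rfl | rfl) <;> simp)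
        (hmono hbT (by rintro (_ | _) <;> simp [e]))
    case a₁ =>
      exact hanti a₀ (by simp) a₂ (by simp) a₁ (by rintro z (rfl | rfl | rfl) <;> simp)
        (hmono hbT (by rintro (_ | _) <;> simp [e]))
    case a₂ =>
      exact hanti a₀ (by simp) a₁ (by simp) a₂ (by rintro z (rfl | rfl | rfl) <;> simp)
        (hmono hbT (by rintro (_ | _) <;> simp [e]))
    case x =>
      rcases hmiss (Or.inl rfl) with h | h | h
      · exact (hfail a₁ (by simp) a₂ (by simp)).1
          (hmono₂ h hbT (by rintro (_ | _) <;> simp [e]))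
      · exact (hfail a₀ (by simp) a₂ (by simp)).1
          (hmono₂ h hbT (by rintro (_ | _) <;> simp [e]))
      · exact (hfail a₀ (by simp) a₁ (by simp)).1
          (hmono₂ h hbT (by rintro (_ | _) <;> simp [e]))
    case y =>
      rcases hmiss (Or.inr rfl) with h | h | h
      · exact (hfail a₁ (by simp) a₂ (by simp)).2
          (hmono₂ h hbT (by rintro (_ | _) <;> simp [e]))
      · exact (hfail a₀ (by simp) a₂ (by simp)).2
          (hmono₂ h hbT (by rintro (_ | _) <;> simp [e]))
      · exact (hfail a₀ (by simp) a₁ (by simp)).2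
          (hmono₂ h hbT (by rintro (_ | _) <;> simp [e]))
  refine ⟨e, fun b c hbc => ?_, fun T hT => htrace T (mem_alignment_exampleGeometry.1 hT)⟩
  -- Singletons are closed in the example, so `htrace` separates points.
  refine htrace {c} (by cases c <;> simp) b (hmem ⟨c, rfl, hbc.symm⟩)

theorem minimal_exampleGeometry {A : Type*} [Finite A] {φ : ClosureOperator (Set A)}
    (hφ : IsConvexGeometry φ) (h : ¬ WeakCarouselRule23 φ) :
    Nat.card BaseSet ≤ Nat.card A ∧
      (alignment exampleGeometry).ncard ≤ (alignment φ).ncard := by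
  obtain ⟨e, he, htrace⟩ := exists_trace_of_not_weakCarouselRule23 hφ h
  refine ⟨Nat.card_le_card_of_injective e he,
    Set.ncard_le_ncard_of_injOn (fun T => φ (e '' T)) (fun T _ => φ.idempotent _) ?_⟩
  have hle : ∀ T U, U ∈ alignment exampleGeometry → φ (e '' T) = φ (e '' U) → T ⊆ U :=
    fun T U hU hTU b hb => htrace U hU b (hTU ▸ φ.le_closure _ ⟨b, hb, rfl⟩)
  exact fun T hT U hU hTU => (hle T U hU hTU).antisymm (hle U T hT hTU.symm)

theorem mainTheorem3 :
    IsConvexGeometry exampleGeometry ∧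
    alignment exampleGeometry =
      Set.univ \ {{BaseSet.a₀, BaseSet.a₁, BaseSet.a₂},
        {BaseSet.a₀, BaseSet.a₁, BaseSet.a₂, BaseSet.x},
        {BaseSet.a₀, BaseSet.a₁, BaseSet.a₂, BaseSet.y}} ∧
    ¬ CarouselRule 2 exampleGeometry ∧
    ¬ WeakCarouselRule 2 exampleGeometry ∧
    ¬ WeakCarouselRule23 exampleGeometry ∧
    (∀ X : Set PlaneCircle, ¬ HasStrongRepresentation exampleGeometry (circleGeometry X)) ∧
    (∀ (A : Type*) [Finite A] (φ : ClosureOperator (Set A)),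
      IsConvexGeometry φ → ¬ WeakCarouselRule23 φ →
        Nat.card BaseSet ≤ Nat.card A ∧
        (alignment exampleGeometry).ncard ≤ (alignment φ).ncard) := by
  refine ⟨isConvexGeometry_exampleGeometry, alignment_exampleGeometry, ?_,
    not_weakCarouselRule_exampleGeometry, not_weakCarouselRule23_exampleGeometry,
    not_hasStrongRepresentation_circleGeometry, fun A _ φ => minimal_exampleGeometry⟩
  intro h
  refine not_weakCarouselRule_exampleGeometry fun S p q hp hq => ?_
  obtain ⟨a, ha, hpa⟩ := h S p q hp hq
  exact ⟨a, ha, Or.inl hpa⟩
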